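/- Let $(A,\alpha)$ and $(B,\beta)$ be $\mathbb Z_2$-graded $C^*$-algebras (not necessarily unital), i.e. $\alpha$ and $\beta$ are $*$-automorphisms of $A$ and $B$ with $\alpha^2=\mathrm{id}$, $\beta^2=\mathrm{id}$; for $i\in\{1,-1\}$ let $A_i=\{a:\alpha(a)=ia\}$ and $B_i=\{b:\beta(b)=ib\}$ be the homogeneous parts. Put $\varepsilon(i,j)=-1$ if $i=j=-1$ and $\varepsilon(i,j)=1$ otherwise. The algebraic Fermi tensor product $A\,\circledast_F\,B$ is the algebraic tensor product $A\odot B=\bigoplus_{i,j}A_i\odot B_j$ with the product and the involution determined by $$(a\otimes b)(a'\otimes b')=\varepsilon(j,k)\,aa'\otimes bb',\qquad (a\otimes b)^*=\varepsilon(i,j)\,a^*\otimes b^*$$ for $a\in A_i$, $b\in B_j$, $a'\in A_k$, $b'\in B_l$. For $c\in A\,\circledast_F\,B$ set $$\|c\|_{\max}:=\sup\{\|\pi(c)\| : \pi \text{ a } *\text{-representation of } A\,\circledast_F\,B \text{ by bounded operators on a complex Hilbert space}\}.$$ Then $\|c\|_{\max}<\infty$ for every $c$, and $\|\cdot\|_{\max}$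 is a $C^*$-norm on $A\,\circledast_F\,B$: it is a norm (in particular $\|c\|_{\max}=0$ only if $c=0$), it is submultiplicative, and $\|c^*\|_{\max}=\|c\|_{\max}$, $\|c^*c\|_{\max}=\|c\|_{\max}^2$. Consequently the completion of $A\,\circledast_F\,B$ with respect to $\|\cdot\|_{\max}$ is a $C^*$-algebra (the Fermi $C^*$-tensor product of $A$ and $B$): there are a $C^*$-algebra $C$ and a $*$-homomorphism $\iota:A\,\circledast_F\,B\to C$ with dense range such that $\|\iota(c)\|=\|c\|_{\max}$ for all $c$. -/

import Mathlib

open scoped TensorProduct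

universe u v

noncomputable section

/-- A `ℤ₂`-grading of a (not necessarily unital) C⋆-algebra: an involutive `*`-automorphism. -/
structure Z2Grading (A : Type u) [NonUnitalCStarAlgebra A] where
  aut : A ≃⋆ₐ[ℂ] A
  aut_aut : ∀ a, aut (aut a) = a

namespace Z2Grading

variable {A : Type u} [NonUnitalCStarAlgebra A] (α : Z2Grading A)

/-- The projection `(id + i θ) / 2` onto the homogeneous part of degree `i ∈ ℤ₂ = {1, -1}`. -/
def proj (i : ℤˣ) : A →ₗ[ℂ] A where
  toFun a := (1 / 2 : ℂ) • (a + ((i : ℤ) : ℂ) • α.aut a)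
  map_add' a b := by simp only [map_add, smul_add]; abel
  map_smul' r a := by
    simp only [map_smul, smul_add, RingHom.id_apply]
    rw [smul_comm r (1 / 2 : ℂ) a, smul_comm r (1 / 2 : ℂ), smul_comm r (((i : ℤ) : ℂ))]

theorem proj_apply (i : ℤˣ) (a : A) :
    α.proj i a = (1 / 2 : ℂ) • (a + ((i : ℤ) : ℂ) • α.aut a) := rfl

/-- `a` is homogeneous of degree `i ∈ {1, -1}`: `θ(a) = i a`. -/
def IsHom (i : ℤˣ) (a : A) : Prop := α.aut a = ((i : ℤ) : ℂ) • a

theorem isHom_proj (i : ℤˣ) (a : A) : α.IsHom i (α.proj i a) := by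
  rcases Int.units_eq_one_or i with rfl | rfl <;>
    simp [IsHom, proj_apply, α.aut_aut, add_comm]

theorem sum_proj (a : A) : α.proj 1 a + α.proj (-1) a = a := by
  simp only [proj_apply, Units.val_one, Int.cast_one, one_smul, Units.val_neg, Int.cast_neg,
    neg_smul, ← smul_add]
  rw [add_add_add_comm, add_neg_cancel, add_zero, ← two_smul ℂ a, smul_smul]
  norm_num

variable {α}

theorem IsHom.proj_eq {i : ℤˣ} {a : A} (h : α.IsHom i a) (j : ℤˣ) :
    α.proj j a = if j = i then a else 0 := by
  rw [IsHom] at h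
  rw [proj_apply, h]
  have hh : ((2 : ℂ)⁻¹) • (a + a) = a := by
    rw [← two_smul ℂ a, smul_smul]; norm_num
  rcases Int.units_eq_one_or i with rfl | rfl <;> rcases Int.units_eq_one_or j with rfl | rfl <;>
    simp [hh]

theorem IsHom.mul {i j : ℤˣ} {a b : A} (ha : α.IsHom i a) (hb : α.IsHom j b) :
    α.IsHom (i * j) (a * b) := by
  rw [IsHom] at *
  rw [map_mul, ha, hb, smul_mul_smul_comm]
  push_cast
  rfl

theorem IsHom.star {i : ℤˣ} {a : A} (ha : α.IsHom i a) : α.IsHom i (star a) := by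
  rw [IsHom] at *
  rw [map_star, ha, star_smul]
  simp

end Z2Grading

/-- The sign `ε(i, j)`: it is `-1` if `i = j = -1`, and `1` otherwise. -/
def fermiSign (i j : ℤˣ) : ℂ := if i = -1 ∧ j = -1 then -1 else 1

theorem fermiSign_mul_left (i j k : ℤˣ) :
    fermiSign (i * j) k = fermiSign i k * fermiSign j k := by
  rcases Int.units_eq_one_or i with rfl | rfl <;> rcases Int.units_eq_one_or j with rfl | rfl <;>
    rcases Int.units_eq_one_or k with rfl | rfl <;> simp [fermiSign]

theorem fermiSign_comm (i j : ℤˣ) : fermiSign i j = fermiSign j i := by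
  simp [fermiSign, and_comm]

theorem fermiSign_mul_right (i j k : ℤˣ) :
    fermiSign i (j * k) = fermiSign i j * fermiSign i k := by
  simp only [fermiSign_comm i, fermiSign_mul_left]

theorem fermiSign_mul_self (i j : ℤˣ) : fermiSign i j * fermiSign i j = 1 := by
  unfold fermiSign; split_ifs <;> simp

theorem star_fermiSign (i j : ℤˣ) : star (fermiSign i j) = fermiSign i j := by
  unfold fermiSign; split_ifs <;> simp

variable {A : Type u} {B : Type v} [NonUnitalCStarAlgebra A] [NonUnitalCStarAlgebra B]

/-- The algebraic Fermi tensor product of the `ℤ₂`-graded C⋆-algebras `(A, α)` and `(B, β)`: the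
vector space `A ⊗ B`, with the product and the involution given below. -/
def FermiTensor (_ : Z2Grading A) (_ : Z2Grading B) : Type (max u v) := A ⊗[ℂ] B

namespace FermiTensor

variable (α : Z2Grading A) (β : Z2Grading B)

instance : AddCommGroup (FermiTensor α β) := inferInstanceAs (AddCommGroup (A ⊗[ℂ] B))

instance : Module ℂ (FermiTensor α β) := inferInstanceAs (Module ℂ (A ⊗[ℂ] B))

/-- The identity map, from `A ⊗ B` to the Fermi tensor product. -/
def of : A ⊗[ℂ] B ≃ₗ[ℂ] FermiTensor α β := LinearEquiv.refl ℂ (A ⊗[ℂ] B)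

variable {α β}

/-- The component `x_{i,j} ∈ A_i ⊗ B_j` of `x`. -/
def comp (i j : ℤˣ) : FermiTensor α β →ₗ[ℂ] A ⊗[ℂ] B :=
  TensorProduct.map (α.proj i) (β.proj j) ∘ₗ (of α β).symm.toLinearMap

/-- `x y = ∑ ε(j, k) x_{i,j} · y_{k,l}`, with the usual product of `A ⊗ B` on the right. -/
instance : Mul (FermiTensor α β) where
  mul x y := of α β (∑ i : ℤˣ, ∑ j : ℤˣ, ∑ k : ℤˣ, ∑ l : ℤˣ,
    fermiSign j k • (comp i j x * comp k l y))

/-- `x^* = ∑ ε(i, j) x_{i,j}^†`, with the usual involution of `A ⊗ B` on the right. -/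
instance : Star (FermiTensor α β) where
  star x := of α β (∑ i : ℤˣ, ∑ j : ℤˣ, fermiSign i j • star (comp i j x))

theorem mul_def (x y : FermiTensor α β) :
    x * y = of α β (∑ i : ℤˣ, ∑ j : ℤˣ, ∑ k : ℤˣ, ∑ l : ℤˣ,
      fermiSign j k • (comp i j x * comp k l y)) := rfl

theorem star_def (x : FermiTensor α β) :
    star x = of α β (∑ i : ℤˣ, ∑ j : ℤˣ, fermiSign i j • star (comp i j x)) := rfl

theorem comp_of_tmul (i j : ℤˣ) (a : A) (b : B) :
    comp i j (of α β (a ⊗ₜ b)) = α.proj i a ⊗ₜ β.proj j b := rfl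

@[elab_as_elim]
theorem hom_induction {P : FermiTensor α β → Prop} (x : FermiTensor α β)
    (add : ∀ x y, P x → P y → P (x + y))
    (tmul : ∀ (i j : ℤˣ) (a : A) (b : B), α.IsHom i a → β.IsHom j b → P (of α β (a ⊗ₜ b))) :
    P x := by
  have h : ∀ z : A ⊗[ℂ] B, P (of α β z) := by
    intro z
    induction z using TensorProduct.induction_on with
    | zero =>
      have := tmul 1 1 (0 : A) (0 : B) (by simp [Z2Grading.IsHom]) (by simp [Z2Grading.IsHom])
      simpa using this
    | tmul a b =>
      rw [← α.sum_proj a, ← β.sum_proj b]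
      simp only [TensorProduct.add_tmul, TensorProduct.tmul_add, map_add]
      refine add _ _ (add _ _ ?_ ?_) (add _ _ ?_ ?_) <;>
        exact tmul _ _ _ _ (α.isHom_proj _ _) (β.isHom_proj _ _)
    | add x y hx hy => rw [map_add]; exact add _ _ hx hy
  exact h x

theorem tmul_mul_tmul {i j k l : ℤˣ} {a a' : A} {b b' : B} (ha : α.IsHom i a) (hb : β.IsHom j b)
    (ha' : α.IsHom k a') (hb' : β.IsHom l b') :
    of α β (a ⊗ₜ b) * of α β (a' ⊗ₜ b') = fermiSign j k • of α β ((a * a') ⊗ₜ (b * b')) := by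
  rw [mul_def, ← map_smul]
  congr 1
  simp only [comp_of_tmul, ha.proj_eq, hb.proj_eq, ha'.proj_eq, hb'.proj_eq,
    Algebra.TensorProduct.tmul_mul_tmul]
  rw [Finset.sum_eq_single i (by intro m _ hm; simp [hm]) (fun h => absurd (Finset.mem_univ _) h),
    Finset.sum_eq_single j (by intro m _ hm; simp [hm]) (fun h => absurd (Finset.mem_univ _) h),
    Finset.sum_eq_single k (by intro m _ hm; simp [hm]) (fun h => absurd (Finset.mem_univ _) h),
    Finset.sum_eq_single l (by intro m _ hm; simp [hm]) (fun h => absurd (Finset.mem_univ _) h)]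
  simp

theorem star_tmul {i j : ℤˣ} {a : A} {b : B} (ha : α.IsHom i a) (hb : β.IsHom j b) :
    star (of α β (a ⊗ₜ b)) = fermiSign i j • of α β (star a ⊗ₜ star b) := by
  rw [star_def, ← map_smul]
  congr 1
  simp only [comp_of_tmul, ha.proj_eq, hb.proj_eq, TensorProduct.star_tmul]
  rw [Finset.sum_eq_single i (by intro m _ hm; simp [hm]) (fun h => absurd (Finset.mem_univ _) h),
    Finset.sum_eq_single j (by intro m _ hm; simp [hm]) (fun h => absurd (Finset.mem_univ _) h)]
  simp

instance : NonUnitalNonAssocRing (FermiTensor α β) where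
  left_distrib x y z := by
    simp only [mul_def, map_add, mul_add, smul_add, Finset.sum_add_distrib]
  right_distrib x y z := by
    simp only [mul_def, map_add, add_mul, smul_add, Finset.sum_add_distrib]
  zero_mul x := by simp [mul_def]
  mul_zero x := by simp [mul_def]

instance : SMulCommClass ℂ (FermiTensor α β) (FermiTensor α β) where
  smul_comm r x y := by
    simp only [smul_eq_mul, mul_def, ← map_smul, Finset.smul_sum]
    simp only [map_smul, mul_smul_comm, smul_comm r]

instance : IsScalarTower ℂ (FermiTensor α β) (FermiTensor α β) where
  smul_assoc r x y := by
    simp only [smul_eq_mul, mul_def, ← map_smul, Finset.smul_sum]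
    simp only [map_smul, smul_mul_assoc, smul_comm r]

instance : NonUnitalRing (FermiTensor α β) where
  mul_assoc x y z := by
    induction x using hom_induction with
    | add x x' hx hx' => simp only [add_mul, hx, hx']
    | tmul i j a b ha hb =>
    induction y using hom_induction with
    | add y y' hy hy' => simp only [add_mul, mul_add, hy, hy']
    | tmul i' j' a' b' ha' hb' =>
    induction z using hom_induction with
    | add z z' hz hz' => simp only [mul_add, hz, hz']
    | tmul i'' j'' a'' b'' ha'' hb'' =>
    rw [tmul_mul_tmul ha hb ha' hb', tmul_mul_tmul ha' hb' ha'' hb'', smul_mul_assoc,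
      mul_smul_comm, tmul_mul_tmul (ha.mul ha') (hb.mul hb') ha'' hb'',
      tmul_mul_tmul ha hb (ha'.mul ha'') (hb'.mul hb''), smul_smul, smul_smul,
      fermiSign_mul_left, fermiSign_mul_right, mul_assoc a, mul_assoc b]
    congr 1
    ring

theorem star_add' (x y : FermiTensor α β) : star (x + y) = star x + star y := by
  simp only [star_def, map_add, star_add, smul_add, Finset.sum_add_distrib]

theorem star_smul' (r : ℂ) (x : FermiTensor α β) : star (r • x) = star r • star x := by
  simp only [star_def, Finset.smul_sum, ← map_smul]
  simp only [map_smul, star_smul, smul_comm (star r)]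

instance : StarRing (FermiTensor α β) where
  star_involutive x := by
    induction x using hom_induction with
    | add x y hx hy => rw [star_add', star_add', hx, hy]
    | tmul i j a b ha hb =>
      rw [star_tmul ha hb, star_smul', star_tmul ha.star hb.star, star_fermiSign, smul_smul,
        fermiSign_mul_self, one_smul, star_star, star_star]
  star_mul x y := by
    induction x using hom_induction with
    | add x x' hx hx' => rw [add_mul, star_add', star_add', mul_add, hx, hx']
    | tmul i j a b ha hb =>
    induction y using hom_induction with
    | add y y' hy hy' => rw [mul_add, star_add', star_add', add_mul, hy, hy']
    | tmul k l a' b' ha' hb' =>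
    rw [tmul_mul_tmul ha hb ha' hb', star_smul', star_tmul (ha.mul ha') (hb.mul hb'),
      star_tmul ha hb, star_tmul ha' hb', smul_mul_smul_comm,
      tmul_mul_tmul ha'.star hb'.star ha.star hb.star, star_fermiSign, smul_smul, smul_smul,
      star_mul, star_mul, fermiSign_mul_left, fermiSign_mul_right, fermiSign_mul_right,
      fermiSign_comm k j, fermiSign_comm l i]
    congr 1
    linear_combination (fermiSign i j * fermiSign i l * fermiSign k l) * fermiSign_mul_self j k
  star_add := star_add'

instance : StarModule ℂ (FermiTensor α β) where
  star_smul := star_smul'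

/-- The set of the numbers `‖π(c)‖`, where `π` runs through the `*`-representations of the
algebraic Fermi tensor product by bounded operators on complex Hilbert spaces. (The Hilbert spaces
range over the universe of the Fermi tensor product, which contains a unitary copy of every cyclic
representation.) -/
def repNorms (c : FermiTensor α β) : Set ℝ :=
  {r | ∃ (H : Type (max u v)) (_ : NormedAddCommGroup H) (_ : InnerProductSpace ℂ H)
    (_ : CompleteSpace H) (π : FermiTensor α β →⋆ₙₐ[ℂ] (H →L[ℂ] H)), r = ‖π c‖}

/-- `sup {‖π(c)‖ | π is a representation}`. -/
def maxNorm (c : FermiTensor α β) : ℝ := sSup (repNorms c)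

end FermiTensor

/-- `N` is a C⋆-norm on the complex involutive algebra `C`. -/
structure IsCStarNorm {C : Type u} [NonUnitalRing C] [StarRing C] [Module ℂ C] (N : C → ℝ) :
    Prop where
  nonneg : ∀ x, 0 ≤ N x
  add_le : ∀ x y, N (x + y) ≤ N x + N y
  smul_eq : ∀ (r : ℂ) (x), N (r • x) = ‖r‖ * N x
  eq_zero_iff : ∀ x, N x = 0 ↔ x = 0
  mul_le : ∀ x y, N (x * y) ≤ N x * N y
  star_eq : ∀ x, N (star x) = N x
  star_mul_self : ∀ x, N (star x * x) = N x ^ 2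

end

/-! Finiteness. By the triangle inequality it is enough to bound `π(a ⊗ b)` for homogeneous `a`,
`b`. Since `π(a ⊗ b)^* π(a ⊗ b) = ± π(a^*a ⊗ b^*b)`, one may pass to even self-adjoint `x`, `y`, for
which the signs disappear. Without units `π` does not restrict to the factors. Instead, for fixed
even `y`, the map `a ↦ π(a ⊗ y)` satisfies the hypothesis of `norm_map_mul_le_of_star_mul_eq`, so
left multiplication by `x` costs at most a factor `‖x‖`. Using this in both factors bounds `‖π(x ⊗
y)‖²` by `‖x‖ ‖y‖ ‖π(x ⊗ y)‖`.

Definiteness. A representation `σ` of `A` doubles to `ρ = σ ⊕ σ ∘ α`, whose grading is implemented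
by the swap `U`. For `b` of degree `j` put `a ⊗ b ↦ ρ(a) U^j ⊗ τ(b)`: moving `U^j` past `ρ(a')`
produces exactly the Fermi sign (`fermiRep`). With suitable vectors its matrix coefficients are the
untwisted products of coefficients of `σ` and `τ` (`inner_fermiRep_double`). By GNS and Hahn–Banach
such coefficients separate the points of `A` and of `B`, so their products separate those of `A ⊗
B`.

The remaining axioms hold because `maxNorm` is the pullback of the norm of an `ℓ^∞`-product of
operator algebras; the closure of the image there is the completion. -/

noncomputable section

open UniformSpace

namespace FermiTensor

/-! ### A uniform bound over all representations. -/

section Bounded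

/-- If `⟨ρ(a), ρ(b)⟩ = ψ(a^* b)`, then `ρ` intertwines left multiplication by `x` with an operator
of norm at most `‖x‖`. -/
theorem norm_map_mul_le_of_star_mul_eq {A C : Type*} [NonUnitalCStarAlgebra A]
    [NonUnitalCStarAlgebra C] (ρ ψ : A →ₗ[ℂ] C)
    (h : ∀ a b, star (ρ a) * ρ b = ψ (star a * b)) (x a : A) :
    ‖ρ (x * a)‖ ≤ ‖x‖ * ‖ρ a‖ := by
  let := CStarAlgebra.spectralOrder A
  let := CStarAlgebra.spectralOrderedRing A
  let := CStarAlgebra.spectralOrder C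
  let := CStarAlgebra.spectralOrderedRing C
  -- Positive elements have the form `d^* d`, and `ψ(d^* d) = ρ(d)^* ρ(d)`. Applying the positive
  -- map `ψ` to `a^* x^* x a ≤ ‖x^* x‖ a^* a` then gives the bound.
  have hψ : ∀ y, 0 ≤ y → 0 ≤ ψ y := by
    intro y hy
    obtain ⟨d, rfl⟩ := CStarAlgebra.nonneg_iff_eq_star_mul_self.1 hy
    rw [← h]
    exact star_mul_self_nonneg _
  have hle : star a * (star x * x) * a ≤ ‖star x * x‖ • (star a * a) :=
    CStarAlgebra.star_left_conjugate_le_norm_smul (IsSelfAdjoint.star_mul_self x)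
  have hle' : star (ρ (x * a)) * ρ (x * a) ≤ ((‖x‖ * ‖x‖ : ℝ) : ℂ) • (star (ρ a) * ρ a) := by
    have := hψ _ (sub_nonneg.2 hle)
    rw [map_sub, ← Complex.coe_smul, map_smul, ← h, sub_nonneg, CStarRing.norm_star_mul_self] at this
    rwa [h, star_mul, ← mul_assoc, mul_assoc (star a)]
  have hn := CStarAlgebra.norm_le_norm_of_nonneg_of_le (star_mul_self_nonneg _) hle'
  rw [norm_smul, CStarRing.norm_star_mul_self, CStarRing.norm_star_mul_self, Complex.norm_real,
    Real.norm_of_nonneg (by positivity)] at hn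
  nlinarith [norm_nonneg x, norm_nonneg (ρ a), norm_nonneg (ρ (x * a)),
    mul_nonneg (norm_nonneg x) (norm_nonneg (ρ a))]

variable {A : Type u} {B : Type v} [NonUnitalCStarAlgebra A] [NonUnitalCStarAlgebra B]
  {α : Z2Grading A} {β : Z2Grading B} {C : Type*} [NonUnitalCStarAlgebra C]

/-- The sign only involves the two inner factors `b` and `a'`, so one even inner factor removes it
and the other elements need not be homogeneous. This makes `a ↦ π(a ⊗ y)` usable on all of `A`. -/
theorem tmul_mul_tmul_of_even_right {a a' : A} {b b' : B} (hb : β.IsHom 1 b) :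
    of α β (a ⊗ₜ b) * of α β (a' ⊗ₜ b') = of α β ((a * a') ⊗ₜ (b * b')) := by
  rw [← α.sum_proj a, ← α.sum_proj a', ← β.sum_proj b']
  simp only [TensorProduct.add_tmul, TensorProduct.tmul_add, map_add, add_mul, mul_add,
    tmul_mul_tmul (α.isHom_proj _ _) hb (α.isHom_proj _ _) (β.isHom_proj _ _)]
  simp [fermiSign]

theorem tmul_mul_tmul_of_even_left {a a' : A} {b b' : B} (ha' : α.IsHom 1 a') :
    of α β (a ⊗ₜ b) * of α β (a' ⊗ₜ b') = of α β ((a * a') ⊗ₜ (b * b')) := by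
  rw [← α.sum_proj a, ← β.sum_proj b, ← β.sum_proj b']
  simp only [TensorProduct.add_tmul, TensorProduct.tmul_add, map_add, add_mul, mul_add,
    tmul_mul_tmul (α.isHom_proj _ _) (β.isHom_proj _ _) ha' (β.isHom_proj _ _)]
  simp [fermiSign]

theorem star_tmul_of_even_right {a : A} {b : B} (hb : β.IsHom 1 b) :
    star (of α β (a ⊗ₜ b)) = of α β (star a ⊗ₜ star b) := by
  rw [← α.sum_proj a]
  simp only [TensorProduct.add_tmul, map_add, star_add, star_tmul (α.isHom_proj _ _) hb]
  simp [fermiSign]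

theorem star_tmul_of_even_left {a : A} {b : B} (ha : α.IsHom 1 a) :
    star (of α β (a ⊗ₜ b)) = of α β (star a ⊗ₜ star b) := by
  rw [← β.sum_proj b]
  simp only [TensorProduct.tmul_add, map_add, star_add, star_tmul ha (β.isHom_proj _ _)]
  simp [fermiSign]

theorem norm_map_mul_tmul_le (π : FermiTensor α β →⋆ₙₐ[ℂ] C) {y : B} (hy : β.IsHom 1 y)
    (x a : A) : ‖π (of α β ((x * a) ⊗ₜ y))‖ ≤ ‖x‖ * ‖π (of α β (a ⊗ₜ y))‖ := by
  let L : FermiTensor α β →ₗ[ℂ] C := (π : FermiTensor α β →ₙₐ[ℂ] C)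
  refine norm_map_mul_le_of_star_mul_eq
    (L ∘ₗ (of α β).toLinearMap ∘ₗ (TensorProduct.mk ℂ A B).flip y)
    (L ∘ₗ (of α β).toLinearMap ∘ₗ (TensorProduct.mk ℂ A B).flip (star y * y)) (fun a b => ?_) x a
  change star (π (of α β (a ⊗ₜ y))) * π (of α β (b ⊗ₜ y)) =
    π (of α β ((star a * b) ⊗ₜ (star y * y)))
  rw [← map_star, ← map_mul, star_tmul_of_even_right hy, tmul_mul_tmul_of_even_right hy.star]

theorem norm_map_tmul_mul_le (π : FermiTensor α β →⋆ₙₐ[ℂ] C) {x : A} (hx : α.IsHom 1 x)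
    (y b : B) : ‖π (of α β (x ⊗ₜ (y * b)))‖ ≤ ‖y‖ * ‖π (of α β (x ⊗ₜ b))‖ := by
  let L : FermiTensor α β →ₗ[ℂ] C := (π : FermiTensor α β →ₙₐ[ℂ] C)
  refine norm_map_mul_le_of_star_mul_eq
    (L ∘ₗ (of α β).toLinearMap ∘ₗ TensorProduct.mk ℂ A B x)
    (L ∘ₗ (of α β).toLinearMap ∘ₗ TensorProduct.mk ℂ A B (star x * x)) (fun a b => ?_) y b
  change star (π (of α β (x ⊗ₜ a))) * π (of α β (x ⊗ₜ b)) =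
    π (of α β ((star x * x) ⊗ₜ (star a * b)))
  rw [← map_star, ← map_mul, star_tmul_of_even_left hx, tmul_mul_tmul_of_even_left hx]

/-- With `n = ‖π(x ⊗ y)‖`, the C⋆-identity gives `n² = ‖π(x² ⊗ y²)‖`; pulling out one `y` and then
one `x` gives `n² ≤ ‖x‖ ‖y‖ n`, and `n` cancels. -/
theorem norm_map_tmul_le_of_even (π : FermiTensor α β →⋆ₙₐ[ℂ] C) {x : A} {y : B}
    (hx : α.IsHom 1 x) (hy : β.IsHom 1 y) (hx' : IsSelfAdjoint x) (hy' : IsSelfAdjoint y) :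
    ‖π (of α β (x ⊗ₜ y))‖ ≤ ‖x‖ * ‖y‖ := by
  have hxx : α.IsHom 1 (x * x) := by simpa using hx.mul hx
  have h1 : ‖π (of α β (x ⊗ₜ y))‖ * ‖π (of α β (x ⊗ₜ y))‖ =
      ‖π (of α β ((x * x) ⊗ₜ (y * y)))‖ := by
    rw [← CStarRing.norm_star_mul_self, ← map_star, ← map_mul, star_tmul_of_even_right hy,
      tmul_mul_tmul_of_even_left hx, hx'.star_eq, hy'.star_eq]
  have h2 : ‖π (of α β ((x * x) ⊗ₜ (y * y)))‖ ≤ ‖y‖ * (‖x‖ * ‖π (of α β (x ⊗ₜ y))‖) :=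
    (norm_map_tmul_mul_le π hxx y y).trans
      (mul_le_mul_of_nonneg_left (norm_map_mul_tmul_le π hy x x) (norm_nonneg y))
  by_contra! h
  have hpos : 0 < ‖π (of α β (x ⊗ₜ y))‖ := lt_of_le_of_lt (by positivity) h
  nlinarith

theorem norm_map_tmul_le (π : FermiTensor α β →⋆ₙₐ[ℂ] C) {i j : ℤˣ} {a : A} {b : B}
    (ha : α.IsHom i a) (hb : β.IsHom j b) : ‖π (of α β (a ⊗ₜ b))‖ ≤ ‖a‖ * ‖b‖ := by
  have hsign : ∀ i j, ‖fermiSign i j‖ = 1 := fun i j => by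
    unfold fermiSign; split_ifs <;> simp
  have h1 : ‖π (of α β (a ⊗ₜ b))‖ * ‖π (of α β (a ⊗ₜ b))‖ =
      ‖π (of α β ((star a * a) ⊗ₜ (star b * b)))‖ := by
    rw [← CStarRing.norm_star_mul_self, ← map_star, ← map_mul, star_tmul ha hb, smul_mul_assoc,
      tmul_mul_tmul ha.star hb.star ha hb, map_smul, map_smul, norm_smul, norm_smul, hsign, hsign,
      one_mul, one_mul]
  have h2 := norm_map_tmul_le_of_even π (x := star a * a) (y := star b * b)
    (by simpa using ha.star.mul ha) (by simpa using hb.star.mul hb)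
    (IsSelfAdjoint.star_mul_self a) (IsSelfAdjoint.star_mul_self b)
  rw [← h1, CStarRing.norm_star_mul_self, CStarRing.norm_star_mul_self] at h2
  nlinarith [norm_nonneg (π (of α β (a ⊗ₜ b))), mul_nonneg (norm_nonneg a) (norm_nonneg b)]

theorem bddAbove_repNorms (c : FermiTensor α β) : BddAbove (repNorms c) := by
  induction c using hom_induction with
  | add x y hx hy =>
    obtain ⟨M, hM⟩ := hx
    obtain ⟨N, hN⟩ := hy
    refine ⟨M + N, ?_⟩
    rintro _ ⟨H, _, _, _, π, rfl⟩
    rw [map_add]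
    exact (norm_add_le _ _).trans
      (add_le_add (hM ⟨H, _, _, _, π, rfl⟩) (hN ⟨H, _, _, _, π, rfl⟩))
  | tmul i j a b ha hb =>
    refine ⟨‖a‖ * ‖b‖, ?_⟩
    rintro _ ⟨H, _, _, _, π, rfl⟩
    exact norm_map_tmul_le π ha hb

end Bounded
end FermiTensor

/-! ### Separation of points by positive functionals, by GNS representations and by product
functionals. -/

section Separation

open scoped ComplexOrder

/-- Hahn–Banach: `-x` lies outside the closed convex cone of positive elements, so a real functional
that is nonnegative on the cone is negative at `-x`. -/
theorem exists_positiveLinearMap_apply_ne_zero {A : Type*} [NonUnitalCStarAlgebra A]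
    [PartialOrder A] [StarOrderedRing A] {x : A} (hx : 0 ≤ x) (hx0 : x ≠ 0) :
    ∃ f : A →ₚ[ℂ] ℂ, f x ≠ 0 := by
  have hmem : -x ∉ ProperCone.positive ℝ A := by
    intro h
    have h' : 0 ≤ -x := h
    exact hx0 (le_antisymm (neg_nonneg.1 h') hx)
  obtain ⟨f, hf, hfx⟩ := ProperCone.hyperplane_separation_point _ hmem
  -- Composing with the real part forces `g (i y) = 0` for self-adjoint `y`, so the complex
  -- extension `g y - i g (i y)` agrees with `f` on positive elements.
  let g : Module.Dual ℝ A := f.toLinearMap ∘ₗ (selfAdjoint.submodule ℝ A).subtype ∘ₗ realPart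
  have hg : ∀ y, 0 ≤ y → Module.Dual.extendRCLike (𝕜 := ℂ) g y = (f y : ℂ) := by
    intro y hy
    have h1 : g y = f y := by
      change f (realPart y : A) = f y
      rw [(IsSelfAdjoint.of_nonneg hy).coe_realPart]
    have h2 : g (Complex.I • y) = 0 := by
      change f (realPart (Complex.I • y) : A) = 0
      rw [realPart_I_smul, (IsSelfAdjoint.of_nonneg hy).imaginaryPart]
      simp
    simp [Module.Dual.extendRCLike_apply, h1, h2]
  refine ⟨PositiveLinearMap.mk₀ (Module.Dual.extendRCLike (𝕜 := ℂ) g) fun y hy => ?_, ?_⟩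
  · rw [hg y hy]
    exact_mod_cast hf y hy
  · have : Module.Dual.extendRCLike (𝕜 := ℂ) g x ≠ 0 := by
      rw [hg x hx]
      rw [map_neg] at hfx
      exact_mod_cast (by linarith : 0 < f x).ne'
    exact this

theorem exists_nonUnitalStarAlgHom_apply_ne_zero {A : Type u} [NonUnitalCStarAlgebra A] {a : A}
    (ha : a ≠ 0) :
    ∃ (H : Type u) (_ : NormedAddCommGroup H) (_ : InnerProductSpace ℂ H) (_ : CompleteSpace H)
      (σ : A →⋆ₙₐ[ℂ] (H →L[ℂ] H)), σ a ≠ 0 := by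
  let := CStarAlgebra.spectralOrder A
  let := CStarAlgebra.spectralOrderedRing A
  -- The class of `a^*` replaces the cyclic vector, as there is no unit: `a` sends it to the class
  -- of `a a^*`, whose squared norm is `f` of this element.
  have h2 : star (a * star a) * (a * star a) ≠ 0 := by
    rwa [ne_eq, CStarRing.star_mul_self_eq_zero_iff, CStarRing.mul_star_self_eq_zero_iff]
  obtain ⟨f, hf⟩ := exists_positiveLinearMap_apply_ne_zero (star_mul_self_nonneg (a * star a)) h2
  refine ⟨f.GNS, inferInstance, inferInstance, inferInstance, f.gnsNonUnitalStarAlgHom, ?_⟩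
  intro h0
  apply hf
  have h3 : f.gnsNonUnitalStarAlgHom a (f.toPreGNS (star a) : f.PreGNS) = 0 := by rw [h0]; rfl
  rw [PositiveLinearMap.gnsNonUnitalStarAlgHom_apply_coe] at h3
  have h4 : ‖f.leftMulMapPreGNS a (f.toPreGNS (star a))‖ = 0 := by
    rw [← UniformSpace.Completion.norm_coe, h3, norm_zero]
  have h5 := f.preGNS_norm_sq (f.leftMulMapPreGNS a (f.toPreGNS (star a)))
  rw [h4] at h5
  simpa using h5.symm

/-- Slicing `z` by `ψ` gives a vector of `V` annihilated by `Φ`, hence zero. Expand `z` along a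
basis of `V` with coefficients in `W`: the value of `ψ` on a coefficient is a coordinate of that
slice, so `Ψ` annihilates every coefficient. -/
theorem TensorProduct.eq_zero_of_separating {K V W : Type*} [Field K] [AddCommGroup V] [Module K V]
    [AddCommGroup W] [Module K W] {Φ : Set (Module.Dual K V)} {Ψ : Set (Module.Dual K W)}
    (hΦ : ∀ x, (∀ φ ∈ Φ, φ x = 0) → x = 0) (hΨ : ∀ y, (∀ ψ ∈ Ψ, ψ y = 0) → y = 0)
    (z : V ⊗[K] W)
    (hz : ∀ φ ∈ Φ, ∀ ψ ∈ Ψ, LinearMap.mul' K K (TensorProduct.map φ ψ z) = 0) : z = 0 := by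
  classical
  let e := Module.Basis.ofVectorSpace K V
  have h1 : ∀ ψ ∈ Ψ, TensorProduct.rid K V (ψ.lTensor V z) = 0 := by
    intro ψ hψ
    refine hΦ _ fun φ hφ => ?_
    rw [← hz φ hφ ψ hψ]
    clear hz
    induction z with
    | zero => simp
    | tmul x y => simp [mul_comm]
    | add x y hx hy => simp only [map_add, hx, hy]
  rw [← (TensorProduct.equivFinsuppOfBasisLeft (N := W) e).map_eq_zero_iff]
  ext i
  refine hΨ _ fun ψ hψ => ?_
  have h2 : ψ (TensorProduct.equivFinsuppOfBasisLeft e z i) =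
      e.repr (TensorProduct.rid K V (ψ.lTensor V z)) i := by
    clear hz h1
    induction z with
    | zero => simp
    | tmul x y => simp [mul_comm]
    | add x y hx hy => simp only [map_add, Finsupp.add_apply, hx, hy]
  rw [h2, h1 ψ hψ]
  simp

end Separation

/-! ### Operators on the Hilbert space tensor product. -/

section HilbertTensor

variable {H K : Type*} [NormedAddCommGroup H] [InnerProductSpace ℂ H]
  [NormedAddCommGroup K] [InnerProductSpace ℂ K]

/-- The bounded operator `S ⊗ T` on the Hilbert space tensor product of `H` and `K`. -/
def tensorOp (S : H →L[ℂ] H) (T : K →L[ℂ] K) :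
    Completion (H ⊗[ℂ] K) →L[ℂ] Completion (H ⊗[ℂ] K) :=
  (TensorProduct.mapL S T).completion

theorem tensorOp_coe (S : H →L[ℂ] H) (T : K →L[ℂ] K) (z : H ⊗[ℂ] K) :
    tensorOp S T (z : Completion (H ⊗[ℂ] K)) = (TensorProduct.mapL S T z : H ⊗[ℂ] K) :=
  ContinuousLinearMap.completion_apply_coe _ _

theorem ext_completion_tensor {S T : Completion (H ⊗[ℂ] K) →L[ℂ] Completion (H ⊗[ℂ] K)}
    (h : ∀ z : H ⊗[ℂ] K, S z = T z) : S = T := by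
  ext x
  induction x using Completion.induction_on with
  | hp => exact isClosed_eq S.continuous T.continuous
  | ih z => exact h z

theorem tensorOp_add_left (S S' : H →L[ℂ] H) (T : K →L[ℂ] K) :
    tensorOp (S + S') T = tensorOp S T + tensorOp S' T :=
  ext_completion_tensor fun z => by
    simp only [tensorOp_coe, add_apply, TensorProduct.mapL_add_left,
      Completion.coe_add]

theorem tensorOp_add_right (S : H →L[ℂ] H) (T T' : K →L[ℂ] K) :
    tensorOp S (T + T') = tensorOp S T + tensorOp S T' :=
  ext_completion_tensor fun z => by
    simp only [tensorOp_coe, add_apply, TensorProduct.mapL_add_right,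
      Completion.coe_add]

theorem tensorOp_smul_left (r : ℂ) (S : H →L[ℂ] H) (T : K →L[ℂ] K) :
    tensorOp (r • S) T = r • tensorOp S T :=
  ext_completion_tensor fun z => by
    simp only [tensorOp_coe, smul_apply, TensorProduct.mapL_smul_left,
      Completion.coe_smul]

theorem tensorOp_smul_right (r : ℂ) (S : H →L[ℂ] H) (T : K →L[ℂ] K) :
    tensorOp S (r • T) = r • tensorOp S T :=
  ext_completion_tensor fun z => by
    simp only [tensorOp_coe, smul_apply, TensorProduct.mapL_smul_right,
      Completion.coe_smul]

theorem tensorOp_mul (S S' : H →L[ℂ] H) (T T' : K →L[ℂ] K) :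
    tensorOp S T * tensorOp S' T' = tensorOp (S * S') (T * T') :=
  ext_completion_tensor fun z => by
    change tensorOp S T (tensorOp S' T' z) = _
    simp only [tensorOp_coe, TensorProduct.mapL_mul]
    rfl

theorem star_tensorOp [CompleteSpace H] [CompleteSpace K] (S : H →L[ℂ] H) (T : K →L[ℂ] K) :
    star (tensorOp S T) = tensorOp (star S) (star T) := by
  symm
  refine (ContinuousLinearMap.eq_adjoint_iff _ _).2 fun x y => ?_
  induction x, y using Completion.induction_on₂ with
  | hp => apply isClosed_eq <;> fun_prop
  | ih x y =>
    simp only [tensorOp_coe, Completion.inner_coe]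
    induction x with
    | zero => simp
    | add x x' hx hx' => simp only [map_add, inner_add_left, hx, hx']
    | tmul a b =>
      induction y with
      | zero => simp
      | add y y' hy hy' => simp only [map_add, inner_add_right, hy, hy']
      | tmul c d =>
        simp only [TensorProduct.mapL_tmul, TensorProduct.inner_tmul,
          ContinuousLinearMap.star_eq_adjoint, ContinuousLinearMap.adjoint_inner_left]

/-- The bilinear map `(S, T) ↦ S ⊗ T`. -/
def tensorOpBilin : (H →L[ℂ] H) →ₗ[ℂ] (K →L[ℂ] K) →ₗ[ℂ]
    (Completion (H ⊗[ℂ] K) →L[ℂ] Completion (H ⊗[ℂ] K)) :=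
  LinearMap.mk₂ ℂ tensorOp tensorOp_add_left tensorOp_smul_left tensorOp_add_right
    tensorOp_smul_right

theorem tensorOp_zero_right (S : H →L[ℂ] H) : tensorOp S (0 : K →L[ℂ] K) = 0 :=
  map_zero (tensorOpBilin S)

end HilbertTensor

/-! ### Covariant representations and the Fermi representations they induce. -/

/-- A covariant representation of a `ℤ₂`-graded C⋆-algebra: a representation together with a
self-adjoint unitary that implements the grading. -/
structure CovariantRep {A : Type*} [NonUnitalCStarAlgebra A] (α : Z2Grading A) (H : Type*)
    [NormedAddCommGroup H] [InnerProductSpace ℂ H] [CompleteSpace H] where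
  rep : A →⋆ₙₐ[ℂ] (H →L[ℂ] H)
  flip : H →L[ℂ] H
  flip_mul_flip : flip * flip = 1
  star_flip : star flip = flip
  flip_mul_rep : ∀ a, flip * rep a = rep (α.aut a) * flip

namespace CovariantRep

section Double

variable {A : Type*} [NonUnitalCStarAlgebra A] {H : Type*}
    [NormedAddCommGroup H] [InnerProductSpace ℂ H]

/-- The operator `(x, y) ↦ (S x, T y)`. -/
def diag (S T : H →L[ℂ] H) : WithLp 2 (H × H) →L[ℂ] WithLp 2 (H × H) :=
  (WithLp.prodContinuousLinearEquiv 2 ℂ H H).symm.toContinuousLinearMap ∘L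
    (S.prodMap T) ∘L (WithLp.prodContinuousLinearEquiv 2 ℂ H H).toContinuousLinearMap

theorem diag_apply (S T : H →L[ℂ] H) (x : WithLp 2 (H × H)) :
    diag S T x = WithLp.toLp 2 (S x.fst, T x.snd) := rfl

/-- The operator `(x, y) ↦ (y, x)`. -/
def swap : WithLp 2 (H × H) →L[ℂ] WithLp 2 (H × H) :=
  (WithLp.prodContinuousLinearEquiv 2 ℂ H H).symm.toContinuousLinearMap ∘L
    (ContinuousLinearEquiv.prodComm ℂ H H).toContinuousLinearMap ∘L
      (WithLp.prodContinuousLinearEquiv 2 ℂ H H).toContinuousLinearMap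

theorem swap_apply (x : WithLp 2 (H × H)) :
    swap x = WithLp.toLp 2 (x.snd, x.fst) := rfl

variable [CompleteSpace H]

/-- The covariant representation on `H ⊕ H` induced by a representation on `H`. -/
def double (α : Z2Grading A) (σ : A →⋆ₙₐ[ℂ] (H →L[ℂ] H)) :
    CovariantRep α (WithLp 2 (H × H)) where
  rep :=
    { toFun a := diag (σ a) (σ (α.aut a))
      map_smul' r a := by ext x; simp [diag_apply, ← WithLp.toLp_smul]
      map_zero' := by ext x; simp [diag_apply]
      map_add' a b := by ext x; simp [diag_apply, ← WithLp.toLp_add]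
      map_mul' a b := by ext x; simp [diag_apply]
      map_star' a := by
        refine (ContinuousLinearMap.eq_adjoint_iff _ _).2 fun x y => ?_
        simp [diag_apply, WithLp.prod_inner_apply, map_star, ContinuousLinearMap.star_eq_adjoint,
          ContinuousLinearMap.adjoint_inner_left] }
  flip := swap
  flip_mul_flip := by ext x; rfl
  star_flip := by
    symm
    refine (ContinuousLinearMap.eq_adjoint_iff _ _).2 fun x y => ?_
    simp [swap_apply, WithLp.prod_inner_apply, add_comm]
  -- The swap exchanges `σ(a)` and `σ(α(a))`; since `α² = id`, this replaces `a` by `α(a)`.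
  flip_mul_rep a := by ext x; simp [diag_apply, swap_apply, α.aut_aut]

theorem double_rep_apply (α : Z2Grading A) (σ : A →⋆ₙₐ[ℂ] (H →L[ℂ] H)) (a : A)
    (x : WithLp 2 (H × H)) :
    (double α σ).rep a x = WithLp.toLp 2 (σ a x.fst, σ (α.aut a) x.snd) := rfl

theorem double_flip_apply (α : Z2Grading A) (σ : A →⋆ₙₐ[ℂ] (H →L[ℂ] H))
    (x : WithLp 2 (H × H)) :
    (double α σ).flip x = WithLp.toLp 2 (x.snd, x.fst) := rfl

end Double

variable {A : Type u} {B : Type v} [NonUnitalCStarAlgebra A] [NonUnitalCStarAlgebra B]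
  {α : Z2Grading A} {β : Z2Grading B} {H K : Type*}
  [NormedAddCommGroup H] [InnerProductSpace ℂ H] [CompleteSpace H]
  [NormedAddCommGroup K] [InnerProductSpace ℂ K] [CompleteSpace K]

/-- The power of the grading operator attached to a degree. -/
def flipPow (ρ : CovariantRep α H) (j : ℤˣ) : H →L[ℂ] H := if j = -1 then ρ.flip else 1

theorem flipPow_mul_flipPow (ρ : CovariantRep α H) (i j : ℤˣ) :
    ρ.flipPow i * ρ.flipPow j = ρ.flipPow (i * j) := by
  rcases Int.units_eq_one_or i with rfl | rfl <;> rcases Int.units_eq_one_or j with rfl | rfl <;>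
    simp [flipPow, ρ.flip_mul_flip]

theorem star_flipPow (ρ : CovariantRep α H) (i : ℤˣ) : star (ρ.flipPow i) = ρ.flipPow i := by
  unfold flipPow
  split_ifs <;> simp [ρ.star_flip]

/-- The source of the Fermi sign: `U` commutes with even and anticommutes with odd elements. -/
theorem flipPow_mul_rep (ρ : CovariantRep α H) {i : ℤˣ} (j : ℤˣ) {a : A} (ha : α.IsHom i a) :
    ρ.flipPow j * ρ.rep a = fermiSign j i • (ρ.rep a * ρ.flipPow j) := by
  rw [Z2Grading.IsHom] at ha
  rcases Int.units_eq_one_or i with rfl | rfl <;> rcases Int.units_eq_one_or j with rfl | rfl <;>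
    simp [flipPow, fermiSign, ρ.flip_mul_rep, ha]

/-- The linear map `a ⊗ b ↦ ρ(a) U^j ⊗ τ(b)`, for `b` of degree `j`. -/
def fermiMap (ρ : CovariantRep α H) (β : Z2Grading B) (τ : B →⋆ₙₐ[ℂ] (K →L[ℂ] K)) :
    FermiTensor α β →ₗ[ℂ] (Completion (H ⊗[ℂ] K) →L[ℂ] Completion (H ⊗[ℂ] K)) :=
  (∑ j : ℤˣ, TensorProduct.lift (tensorOpBilin.compl₁₂
    (LinearMap.mulRight ℂ (ρ.flipPow j) ∘ₗ ((ρ.rep : A →ₙₐ[ℂ] (H →L[ℂ] H)) : A →ₗ[ℂ] (H →L[ℂ] H)))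
    (((τ : B →ₙₐ[ℂ] (K →L[ℂ] K)) : B →ₗ[ℂ] (K →L[ℂ] K)) ∘ₗ β.proj j))) ∘ₗ
      (FermiTensor.of α β).symm.toLinearMap

theorem fermiMap_of_tmul (ρ : CovariantRep α H) (τ : B →⋆ₙₐ[ℂ] (K →L[ℂ] K)) (a : A) (b : B) :
    ρ.fermiMap β τ (FermiTensor.of α β (a ⊗ₜ b)) =
      ∑ j : ℤˣ, tensorOp (ρ.rep a * ρ.flipPow j) (τ (β.proj j b)) := by
  simp only [fermiMap, LinearMap.comp_apply, LinearEquiv.coe_coe, LinearEquiv.symm_apply_apply,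
    LinearMap.sum_apply]
  rfl

theorem fermiMap_of_tmul_of_isHom (ρ : CovariantRep α H) (τ : B →⋆ₙₐ[ℂ] (K →L[ℂ] K)) (a : A)
    {j : ℤˣ} {b : B} (hb : β.IsHom j b) :
    ρ.fermiMap β τ (FermiTensor.of α β (a ⊗ₜ b)) = tensorOp (ρ.rep a * ρ.flipPow j) (τ b) := by
  rw [fermiMap_of_tmul, Finset.sum_eq_single j]
  · simp [hb.proj_eq]
  · intro k _ hk
    simp [hb.proj_eq, hk, tensorOp_zero_right]
  · exact fun h => absurd (Finset.mem_univ j) h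

/-- The representation of the Fermi tensor product induced by a covariant representation of the
first factor and a representation of the second. -/
def fermiRep (ρ : CovariantRep α H) (β : Z2Grading B) (τ : B →⋆ₙₐ[ℂ] (K →L[ℂ] K)) :
    FermiTensor α β →⋆ₙₐ[ℂ] (Completion (H ⊗[ℂ] K) →L[ℂ] Completion (H ⊗[ℂ] K)) where
  toFun := ρ.fermiMap β τ
  map_smul' := map_smul _
  map_zero' := map_zero _
  map_add' := map_add _
  map_mul' x y := by
    induction x using FermiTensor.hom_induction with
    | add x x' hx hx' => simp only [add_mul, map_add, hx, hx']
    | tmul i j a b ha hb =>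
    induction y using FermiTensor.hom_induction with
    | add y y' hy hy' => simp only [mul_add, map_add, hy, hy']
    | tmul k l a' b' ha' hb' =>
    -- In the first tensor factor, `ρ(a) U^j ρ(a') U^l = ε(j, k) ρ(a a') U^(jl)`.
    rw [FermiTensor.tmul_mul_tmul ha hb ha' hb', map_smul,
      fermiMap_of_tmul_of_isHom ρ τ _ (hb.mul hb'), fermiMap_of_tmul_of_isHom ρ τ _ hb,
      fermiMap_of_tmul_of_isHom ρ τ _ hb', tensorOp_mul, mul_assoc, ← mul_assoc (ρ.flipPow j),
      flipPow_mul_rep ρ j ha', smul_mul_assoc, mul_smul_comm, tensorOp_smul_left, mul_assoc,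
      flipPow_mul_flipPow, map_mul, map_mul, mul_assoc]
  map_star' x := by
    induction x using FermiTensor.hom_induction with
    | add x x' hx hx' =>
      rw [star_add, map_add, map_add, hx, hx']
      exact (star_add (ρ.fermiMap β τ x) (ρ.fermiMap β τ x')).symm
    | tmul i j a b ha hb =>
    -- In the first tensor factor, `(ρ(a) U^j)^* = U^j ρ(a^*) = ε(j, i) ρ(a^*) U^j`.
    rw [FermiTensor.star_tmul ha hb, map_smul, fermiMap_of_tmul_of_isHom ρ τ _ hb.star,
      fermiMap_of_tmul_of_isHom ρ τ _ hb, star_tensorOp, star_mul, star_flipPow, ← map_star,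
      ← map_star, flipPow_mul_rep ρ j ha.star, tensorOp_smul_left, fermiSign_comm]

theorem fermiRep_of_tmul (ρ : CovariantRep α H) (τ : B →⋆ₙₐ[ℂ] (K →L[ℂ] K)) (a : A) (b : B) :
    ρ.fermiRep β τ (FermiTensor.of α β (a ⊗ₜ b)) =
      ∑ j : ℤˣ, tensorOp (ρ.rep a * ρ.flipPow j) (τ (β.proj j b)) :=
  fermiMap_of_tmul ρ τ a b

end CovariantRep

/-! ### Matrix coefficients and faithfulness. -/

/-- The linear functional `a ↦ ⟨ξ, σ(a) η⟩`. -/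
def vectorFunctional {A H : Type*} [NonUnitalCStarAlgebra A] [NormedAddCommGroup H]
    [InnerProductSpace ℂ H] [CompleteSpace H] (σ : A →⋆ₙₐ[ℂ] (H →L[ℂ] H)) (ξ η : H) :
    Module.Dual ℂ A where
  toFun a := inner ℂ ξ (σ a η)
  map_add' a b := by simp
  map_smul' r a := by simp

theorem vectorFunctional_apply {A H : Type*} [NonUnitalCStarAlgebra A] [NormedAddCommGroup H]
    [InnerProductSpace ℂ H] [CompleteSpace H] (σ : A →⋆ₙₐ[ℂ] (H →L[ℂ] H)) (ξ η : H) (a : A) :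
    vectorFunctional σ ξ η a = inner ℂ ξ (σ a η) := rfl

/-- The matrix coefficients of the representations of a C⋆-algebra. -/
def vectorFunctionals (A : Type u) [NonUnitalCStarAlgebra A] : Set (Module.Dual ℂ A) :=
  {φ | ∃ (H : Type u) (_ : NormedAddCommGroup H) (_ : InnerProductSpace ℂ H) (_ : CompleteSpace H)
    (σ : A →⋆ₙₐ[ℂ] (H →L[ℂ] H)) (ξ η : H), φ = vectorFunctional σ ξ η}

theorem eq_zero_of_vectorFunctionals {A : Type u} [NonUnitalCStarAlgebra A] (a : A)
    (h : ∀ φ ∈ vectorFunctionals A, φ a = 0) : a = 0 := by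
  by_contra ha
  obtain ⟨H, _, _, _, σ, hσ⟩ := exists_nonUnitalStarAlgHom_apply_ne_zero ha
  refine hσ (ContinuousLinearMap.ext fun η => ?_)
  -- Taking `ξ = σ(a) η` turns the coefficient into `‖σ(a) η‖²`.
  have := h _ ⟨H, _, _, _, σ, σ a η, η, rfl⟩
  simpa [vectorFunctional_apply] using this

namespace FermiTensor

variable {A : Type u} {B : Type v} [NonUnitalCStarAlgebra A] [NonUnitalCStarAlgebra B]
  {α : Z2Grading A} {β : Z2Grading B}

/-- The diagonal vector `(ξ', ξ')` is fixed by the swap, so the powers `U^j` disappear, and `(ξ, 0)`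
selects the summand `σ` of `σ ⊕ σ ∘ α`. The degree of `b` thus no longer matters. -/
theorem inner_fermiRep_double {H K : Type*}
    [NormedAddCommGroup H] [InnerProductSpace ℂ H] [CompleteSpace H]
    [NormedAddCommGroup K] [InnerProductSpace ℂ K] [CompleteSpace K]
    (σ : A →⋆ₙₐ[ℂ] (H →L[ℂ] H)) (τ : B →⋆ₙₐ[ℂ] (K →L[ℂ] K)) (ξ ξ' : H) (η η' : K)
    (c : FermiTensor α β) :
    inner ℂ ((WithLp.toLp 2 (ξ, (0 : H)) ⊗ₜ[ℂ] η : WithLp 2 (H × H) ⊗[ℂ] K) :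
        Completion (WithLp 2 (H × H) ⊗[ℂ] K))
      ((CovariantRep.double α σ).fermiRep β τ c
        ((WithLp.toLp 2 (ξ', ξ') ⊗ₜ[ℂ] η' : WithLp 2 (H × H) ⊗[ℂ] K) :
          Completion (WithLp 2 (H × H) ⊗[ℂ] K))) =
      LinearMap.mul' ℂ ℂ (TensorProduct.map (vectorFunctional σ ξ ξ') (vectorFunctional τ η η')
        ((of α β).symm c)) := by
  obtain ⟨z, rfl⟩ := (of α β).surjective c
  rw [LinearEquiv.symm_apply_apply]
  induction z with
  | zero => simp
  | add x y hx hy =>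
    simp only [map_add, add_apply, inner_add_right, hx, hy]
  | tmul a b =>
    have key : ∀ j : ℤˣ, inner ℂ (WithLp.toLp 2 (ξ, (0 : H)))
        (((CovariantRep.double α σ).rep a * (CovariantRep.double α σ).flipPow j)
          (WithLp.toLp 2 (ξ', ξ'))) = vectorFunctional σ ξ ξ' a := by
      intro j
      rcases Int.units_eq_one_or j with rfl | rfl <;>
      simp [CovariantRep.flipPow, WithLp.prod_inner_apply, CovariantRep.double_rep_apply,
        CovariantRep.double_flip_apply, vectorFunctional_apply]
    rw [CovariantRep.fermiRep_of_tmul, sum_apply, inner_sum]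
    simp only [tensorOp_coe, Completion.inner_coe, TensorProduct.mapL_tmul,
      TensorProduct.inner_tmul, key]
    rw [← Finset.mul_sum, ← inner_sum, ← sum_apply, ← map_sum]
    have hb : ∑ j : ℤˣ, β.proj j b = b := by
      conv_rhs => rw [← β.sum_proj b]
      simp [UnitsInt.univ]
    rw [hb]
    rfl

theorem exists_representation_apply_ne_zero {c : FermiTensor α β} (hc : c ≠ 0) :
    ∃ (H : Type (max u v)) (_ : NormedAddCommGroup H) (_ : InnerProductSpace ℂ H)
      (_ : CompleteSpace H) (π : FermiTensor α β →⋆ₙₐ[ℂ] (H →L[ℂ] H)), π c ≠ 0 := by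
  by_contra! h
  apply hc
  rw [← (of α β).symm.map_eq_zero_iff]
  refine TensorProduct.eq_zero_of_separating (eq_zero_of_vectorFunctionals (A := A))
    (eq_zero_of_vectorFunctionals (A := B)) _ ?_
  rintro _ ⟨H, _, _, _, σ, ξ, ξ', rfl⟩ _ ⟨K, _, _, _, τ, η, η', rfl⟩
  rw [← inner_fermiRep_double, h]
  simp

end FermiTensor

/-! ### The C⋆-norm axioms and the completion. -/

/-- The pullback of the norm of a C⋆-algebra along a `*`-homomorphism is a C⋆-norm as soon as it is
definite. -/
theorem IsCStarNorm.of_norm_hom {F : Type u} {D : Type*} [NonUnitalRing F] [StarRing F]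
    [Module ℂ F] [NonUnitalCStarAlgebra D] (φ : F →⋆ₙₐ[ℂ] D) {N : F → ℝ}
    (hN : ∀ x, N x = ‖φ x‖) (h0 : ∀ x, N x = 0 ↔ x = 0) : IsCStarNorm N where
  nonneg x := hN x ▸ norm_nonneg _
  add_le x y := by simpa only [hN, map_add] using norm_add_le _ _
  smul_eq r x := by simpa only [hN, map_smul] using norm_smul _ _
  eq_zero_iff := h0
  mul_le x y := by simpa only [hN, map_mul] using norm_mul_le _ _
  star_eq x := by simpa only [hN, map_star] using norm_star _
  star_mul_self x := by
    simp only [hN, map_mul, map_star, CStarRing.norm_star_mul_self, sq]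

namespace FermiTensor

open scoped ENNReal

variable {A : Type u} {B : Type v} [NonUnitalCStarAlgebra A] [NonUnitalCStarAlgebra B]

/-- A `*`-representation of the algebraic Fermi tensor product on a Hilbert space. -/
structure Representation (α : Z2Grading A) (β : Z2Grading B) where
  space : Type (max u v)
  [normedAddCommGroup : NormedAddCommGroup space]
  [innerProductSpace : InnerProductSpace ℂ space]
  [completeSpace : CompleteSpace space]
  hom : FermiTensor α β →⋆ₙₐ[ℂ] (space →L[ℂ] space)

namespace Representation

attribute [instance] normedAddCommGroup innerProductSpace completeSpace

end Representation

variable {α : Z2Grading A} {β : Z2Grading B}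

theorem norm_hom_le_maxNorm (π : Representation α β) (c : FermiTensor α β) :
    ‖π.hom c‖ ≤ maxNorm c :=
  le_csSup (bddAbove_repNorms c) ⟨π.space, _, _, _, π.hom, rfl⟩

theorem repNorms_nonempty (c : FermiTensor α β) : (repNorms c).Nonempty :=
  ⟨_, PUnit, inferInstance, inferInstance, inferInstance, 0, rfl⟩

/-- One representation for each element and each tolerance is enough to recover the supremum.
Indexing by `FermiTensor α β × ℕ` keeps the product in `Type (max u v)`, whereas `Representation α
β` itself lives one universe higher. -/
theorem exists_lt_norm_hom (c : FermiTensor α β) (n : ℕ) :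
    ∃ π : Representation α β, maxNorm c - 1 / (n + 1 : ℝ) < ‖π.hom c‖ := by
  obtain ⟨_, ⟨H, _, _, _, π, rfl⟩, h⟩ := exists_lt_of_lt_csSup (repNorms_nonempty c)
    (show maxNorm c - 1 / (n + 1 : ℝ) < sSup (repNorms c) from
      sub_lt_self _ (by positivity))
  exact ⟨⟨H, π⟩, h⟩

/-- A representation that attains the norm of `i.1` up to `1 / (i.2 + 1)`. -/
def almostNorming (i : FermiTensor α β × ℕ) : Representation α β :=
  (exists_lt_norm_hom i.1 i.2).choose

theorem lt_norm_almostNorming (c : FermiTensor α β) (n : ℕ) :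
    maxNorm c - 1 / (n + 1 : ℝ) < ‖(almostNorming (c, n)).hom c‖ :=
  (exists_lt_norm_hom c n).choose_spec

variable (α β) in
/-- The `ℓ^∞`-product of the operator algebras of the almost norming representations. -/
abbrev BoundedFamilies : Type (max u v) :=
  lp (fun i : FermiTensor α β × ℕ => (almostNorming i).space →L[ℂ] (almostNorming i).space) ∞

/-- The `*`-homomorphism into the product of the almost norming representations. -/
def toBoundedFamilies : FermiTensor α β →⋆ₙₐ[ℂ] BoundedFamilies α β where
  toFun c := ⟨fun i => (almostNorming i).hom c, memℓp_infty ⟨maxNorm c, by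
    rintro _ ⟨i, rfl⟩
    exact norm_hom_le_maxNorm _ c⟩⟩
  map_smul' r c := by ext1; funext i; exact map_smul (almostNorming i).hom r c
  map_zero' := by ext1; funext i; exact map_zero (almostNorming i).hom
  map_add' c d := by ext1; funext i; exact map_add (almostNorming i).hom c d
  map_mul' c d := by ext1; funext i; exact map_mul (almostNorming i).hom c d
  map_star' c := by ext1; funext i; exact map_star (almostNorming i).hom c

theorem toBoundedFamilies_apply (c : FermiTensor α β) (i : FermiTensor α β × ℕ) :
    toBoundedFamilies c i = (almostNorming i).hom c := rfl

/-- Every coordinate is at most the supremum, and the coordinates `(c, n)` approach it as `n` grows.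
-/
theorem norm_toBoundedFamilies (c : FermiTensor α β) : ‖toBoundedFamilies c‖ = maxNorm c := by
  apply le_antisymm
  · exact lp.norm_le_of_forall_le
      ((norm_nonneg _).trans (norm_hom_le_maxNorm (almostNorming (c, 0)) c))
      fun i => norm_hom_le_maxNorm _ c
  · refine le_of_forall_pos_lt_add fun ε hε => ?_
    obtain ⟨n, hn⟩ := exists_nat_one_div_lt hε
    have h1 := lt_norm_almostNorming c n
    have h2 := lp.norm_apply_le_norm ENNReal.top_ne_zero (toBoundedFamilies c) (c, n)
    rw [toBoundedFamilies_apply] at h2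
    linarith

theorem maxNorm_eq_zero_iff (c : FermiTensor α β) : maxNorm c = 0 ↔ c = 0 := by
  constructor
  · intro h
    by_contra hc
    obtain ⟨H, _, _, _, π, hπ⟩ := exists_representation_apply_ne_zero hc
    exact hπ (norm_le_zero_iff.1 (h ▸ norm_hom_le_maxNorm ⟨H, π⟩ c))
  · rintro rfl
    rw [← norm_toBoundedFamilies, map_zero, norm_zero]

theorem isCStarNorm_maxNorm : IsCStarNorm (maxNorm : FermiTensor α β → ℝ) :=
  .of_norm_hom toBoundedFamilies (fun c => (norm_toBoundedFamilies c).symm) maxNorm_eq_zero_iff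

end FermiTensor

/-- The closure of the range of a `*`-homomorphism into a C⋆-algebra is a C⋆-algebra. -/
theorem exists_cstarAlgebra_denseRange {F : Type*} {D : Type u} [NonUnitalRing F] [StarRing F]
    [Module ℂ F] [NonUnitalCStarAlgebra D] (φ : F →⋆ₙₐ[ℂ] D) :
    ∃ (C : Type u) (_ : NonUnitalCStarAlgebra C) (ι : F →⋆ₙₐ[ℂ] C),
      DenseRange ι ∧ ∀ c, ‖ι c‖ = ‖φ c‖ := by
  let S := (NonUnitalStarAlgHom.range φ).topologicalClosure
  have : IsClosed (S : Set D) := NonUnitalStarSubalgebra.isClosed_topologicalClosure _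
  have hmem : ∀ c, φ c ∈ S := fun c =>
    NonUnitalStarSubalgebra.le_topologicalClosure _ ⟨c, rfl⟩
  refine ⟨S, inferInstance, NonUnitalStarAlgHom.codRestrict φ S hmem, ?_, fun c => rfl⟩
  rw [DenseRange, Subtype.dense_iff]
  intro x hx
  refine closure_mono ?_ (show x ∈ closure (Set.range φ) from hx)
  rintro _ ⟨c, rfl⟩
  exact ⟨⟨φ c, hmem c⟩, ⟨c, rfl⟩, rfl⟩

end

theorem mainTheorem5 {A : Type u} {B : Type v} [NonUnitalCStarAlgebra A] [NonUnitalCStarAlgebra B]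
    (α : Z2Grading A) (β : Z2Grading B) :
    (∀ c : FermiTensor α β, BddAbove (FermiTensor.repNorms c)) ∧
    IsCStarNorm (FermiTensor.maxNorm : FermiTensor α β → ℝ) ∧
    -- the completion with respect to the norm is a C⋆-algebra
    ∃ (C : Type (max u v)) (_ : NonUnitalCStarAlgebra C) (ι : FermiTensor α β →⋆ₙₐ[ℂ] C),
      DenseRange ι ∧ ∀ c, ‖ι c‖ = FermiTensor.maxNorm c := by
  refine ⟨FermiTensor.bddAbove_repNorms, FermiTensor.isCStarNorm_maxNorm, ?_⟩
  obtain ⟨C, hC, ι, hd, hn⟩ :=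
    exists_cstarAlgebra_denseRange (FermiTensor.toBoundedFamilies (α := α) (β := β))
  exact ⟨C, hC, ι, hd, fun c => (hn c).trans (FermiTensor.norm_toBoundedFamilies c)⟩
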